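/- Let $\overline{\mathbb Q}$ be an algebraic closure of $\mathbb Q$. For a number field $L$ of degree $d$ over $\mathbb Q$ and $\boldsymbol x=(x_1,\dots,x_n)\in L^n$, let $$H(\boldsymbol x)=\prod_{v\mid\infty}\Big(\sum_{i=1}^n\|x_i\|_v^2\Big)^{d_v/2d}\ \prod_{v\nmid\infty}\max_{1\le i\le n}\|x_i\|_v^{d_v/d},$$ where $v$ runs over the places of $L$, $\|\ \|_v$ is the absolute value extending the usual archimedean or $p$-adic absolute value of $\mathbb Q$, and $d_v$ is the local degree of $L$ at $v$. For $\boldsymbol z\in\overline{\mathbb Q}^N$, $H(\boldsymbol z)$ is evaluated over the number field $\mathbb Q(z_1,\dots,z_N)$ generated by its coordinates; for a polynomial $F$ over a number field $K$, $H(F)$ is the height (over $K$) of its vector of coefficients. Fix an embedding $K\subseteq\overline{\mathbb Q}$ and write $\deg_K(\boldsymbol z)=[K(z_1,\dots,z_N):K]$. Let $K$ be a number field and $M\ge1$ an integer. (1) For every $N\ge2$ and every nonzero homogeneous polynomial $F\in K[X_1,\dots,X_N]$ of degree $M$ there exists $\boldsymbol 0\ne\boldsymbol z\in\overline{\mathbb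 Q}^N$ with $\deg_K(\boldsymbol z)\le M$, $F(\boldsymbol z)=0$ and $$H(\boldsymbol z)\le\sqrt2\,H(F)^{1/M}.$$ (2) For $N=2$ the exponent $1/M$ is best possible: for every real $\theta<1/M$ and every real $c$ there is a nonzero homogeneous polynomial $F\in K[X_1,X_2]$ of degree $M$ such that $H(\boldsymbol z)>c\,H(F)^{\theta}$ for every zero $\boldsymbol 0\ne\boldsymbol z\in\overline{\mathbb Q}^2$ of $F$. (3) More explicitly, for every $0\ne C\in K$ and $F=X_1^M-CX_2^M$, every zero $\boldsymbol 0\ne\boldsymbol z\in\overline{\mathbb Q}^2$ of $F$ satisfies $H(\boldsymbol z)\ge\frac1{\sqrt2}H(F)^{1/M}$. -/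

import Mathlib

/-- The absolute height of a vector `x` with coordinates in a number field `K` of degree `d`:
the product over all places `v` of the local heights, which are
`(∑ i, ‖x i‖_v ^ 2) ^ (d_v / (2 * d))` at the archimedean places and
`max i, ‖x i‖_v ^ (d_v / d)` at the non-archimedean ones.
At an infinite place, `v.mult` is the local degree `d_v`. A `FinitePlace` of Mathlib is normalized
by `v a = (N 𝔭) ^ (- ord_𝔭 a)`, that is, `v a = ‖a‖_v ^ d_v`, where `‖ ‖_v` extends the usual
`p`-adic absolute value. The common exponent `1 / d` is taken outside of the product. -/
noncomputable def heightOver (K : Type*) [Field K] [NumberField K] {ι : Type*} [Fintype ι]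
    (x : ι → K) : ℝ :=
  ((∏ v : NumberField.InfinitePlace K, Real.sqrt (∑ i, v (x i) ^ 2) ^ v.mult) *
    ∏ᶠ v : NumberField.FinitePlace K, ⨆ i, v (x i)) ^ (1 / (Module.finrank ℚ K : ℝ))

/-- The field generated over `ℚ` by finitely many algebraic numbers is a number field. -/
theorem numberField_adjoin_range {Qbar : Type*} [Field Qbar] [Algebra ℚ Qbar]
    [IsAlgClosure ℚ Qbar] {ι : Type*} [Finite ι] (x : ι → Qbar) :
    NumberField (IntermediateField.adjoin ℚ (Set.range x)) := by
  have := IsAlgClosure.isAlgebraic (R := ℚ) (K := Qbar)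
  have h : FiniteDimensional ℚ (IntermediateField.adjoin ℚ (Set.range x)) :=
    IntermediateField.finiteDimensional_adjoin
      (fun y _ => (Algebra.IsAlgebraic.isAlgebraic (R := ℚ) y).isIntegral)
  have : CharZero (IntermediateField.adjoin ℚ (Set.range x)) :=
    algebraRat.charZero _
  exact { to_charZero := this, to_finiteDimensional := by convert h; exact Subsingleton.elim _ _ }

/-- The absolute height of a vector of algebraic numbers, evaluated over the number field that
its coordinates generate. -/
noncomputable def absHeight {Qbar : Type*} [Field Qbar] [Algebra ℚ Qbar] [IsAlgClosure ℚ Qbar]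
    {ι : Type*} [Fintype ι] (x : ι → Qbar) : ℝ :=
  letI := numberField_adjoin_range x
  heightOver (IntermediateField.adjoin ℚ (Set.range x))
    (fun i => ⟨x i, IntermediateField.subset_adjoin ℚ (Set.range x) ⟨i, rfl⟩⟩)

/-- The height of a polynomial over a number field: the height of its coefficient vector.
(Coefficients that vanish do not contribute to the height of a nonzero vector.) -/
noncomputable def polyHeight {K : Type*} [Field K] [NumberField K] {σ : Type*}
    (F : MvPolynomial σ K) : ℝ :=
  heightOver K (fun m : F.support => F.coeff m)

/-- The degree over `K` of the field generated over `K` by the coordinates of `z`. -/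
noncomputable def degOver (K : Type*) [Field K] {Qbar : Type*} [Field Qbar] [Algebra K Qbar]
    {ι : Type*} (z : ι → Qbar) : ℕ :=
  Module.finrank K (IntermediateField.adjoin K (Set.range z))

/-! For existence, put f(X) = F(X, 1, 0, ..., 0). If the coefficient of X₁^M in F vanishes, (1, 0,
..., 0) is a zero of height 1. Otherwise f has degree M and splits over a number field L with roots
α_i. At a finite place, Gauss's lemma expresses the maximum of the coefficients of f exactly through
the α_i. At an infinite place, √(t² + 1) ≤ √2 · max(1, t) and Landau's bound for the Mahler measure
by the ℓ² norm cost a factor √2 per root. Multiplying over all places gives ∏ H(α_i, 1) ≤ √2^M H(f)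
≤ √2^M H(F) (`prod_heightOver_affinePoint_le`), so some root does no worse than the geometric mean.

For optimality, a zero of X₁^M - C X₂^M has (z₂^M, z₁^M) proportional to (1, C). Hence H(1, -C) ≤
H(z)^M (`heightOver_pair_le_pow`), with constant 1 instead of 1/√2; taking C = n large defeats every
smaller exponent.

Heights over different fields are compared through their invariance under field extension
(`heightOver_algebraMap`, `absHeight_eq_heightOver`). -/

open NumberField

/-! ### Local norms, the product formula and monotonicity of the height -/

section PlaceProduct

variable {K : Type*} [Field K] [NumberField K] {ι ι' : Type*} [Fintype ι] [Fintype ι']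

/-- The Euclidean norm of a vector at an infinite place. -/
noncomputable def archNorm (v : InfinitePlace K) (x : ι → K) : ℝ :=
  Real.sqrt (∑ i, v (x i) ^ 2)

/-- The product of the local heights of a vector, without normalization by the degree. -/
noncomputable def placeProd (K : Type*) [Field K] [NumberField K] {ι : Type*} [Fintype ι]
    (x : ι → K) : ℝ :=
  (∏ v : InfinitePlace K, archNorm v x ^ v.mult) * ∏ᶠ v : FinitePlace K, ⨆ i, v (x i)

theorem heightOver_eq (x : ι → K) :
    heightOver K x = placeProd K x ^ (1 / (Module.finrank ℚ K : ℝ)) := rfl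

omit [NumberField K] in
theorem archNorm_nonneg (v : InfinitePlace K) (x : ι → K) : 0 ≤ archNorm v x :=
  Real.sqrt_nonneg _

omit [Fintype ι] in
theorem iSup_finitePlace_nonneg (v : FinitePlace K) (x : ι → K) : 0 ≤ ⨆ i, v (x i) :=
  Real.iSup_nonneg fun _ => apply_nonneg v _

theorem le_iSup_finitePlace (v : FinitePlace K) (x : ι → K) (i : ι) : v (x i) ≤ ⨆ i, v (x i) :=
  Finite.le_ciSup (fun i => v (x i)) i

omit [NumberField K] in
theorem archNorm_smul (v : InfinitePlace K) (c : K) (x : ι → K) :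
    archNorm v (c • x) = v c * archNorm v x := by
  simp only [archNorm, Pi.smul_apply, smul_eq_mul, map_mul, mul_pow, ← Finset.mul_sum]
  rw [Real.sqrt_mul (by positivity), Real.sqrt_sq (apply_nonneg v c)]

omit [Fintype ι] in
theorem iSup_finitePlace_smul (v : FinitePlace K) (c : K) (x : ι → K) :
    ⨆ i, v ((c • x) i) = v c * ⨆ i, v (x i) := by
  simp only [Pi.smul_apply, smul_eq_mul, map_mul]
  rw [Real.mul_iSup_of_nonneg (apply_nonneg v c)]

theorem hasFiniteMulSupport_iSup_finitePlace {x : ι → K} (hx : x ≠ 0) :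
    (fun v : FinitePlace K => ⨆ i, v (x i)).HasFiniteMulSupport := by
  have : Nonempty {j // x j ≠ 0} := nonempty_subtype.mpr <| Function.ne_iff.mp hx
  simp_rw [Finite.iSup_eq_iSup_subtype hx]
  exact .iSup fun j => FinitePlace.hasFiniteMulSupport j.2

theorem placeProd_nonneg (x : ι → K) : 0 ≤ placeProd K x :=
  mul_nonneg (Finset.prod_nonneg fun v _ => pow_nonneg (archNorm_nonneg v x) _)
    (finprod_nonneg fun v => iSup_finitePlace_nonneg v x)

theorem heightOver_nonneg (x : ι → K) : 0 ≤ heightOver K x :=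
  Real.rpow_nonneg (placeProd_nonneg x) _

theorem heightOver_pow_finrank (x : ι → K) :
    heightOver K x ^ Module.finrank ℚ K = placeProd K x := by
  have : Module.finrank ℚ K ≠ 0 := Module.finrank_pos.ne'
  rw [heightOver_eq, one_div, Real.rpow_inv_natCast_pow (placeProd_nonneg x) this]

theorem placeProd_smul {c : K} (hc : c ≠ 0) {x : ι → K} (hx : x ≠ 0) :
    placeProd K (c • x) = placeProd K x := by
  simp only [placeProd, archNorm_smul, iSup_finitePlace_smul, mul_pow, Finset.prod_mul_distrib]
  rw [finprod_mul_distrib (FinitePlace.hasFiniteMulSupport hc)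
    (hasFiniteMulSupport_iSup_finitePlace hx), mul_mul_mul_comm, prod_abs_eq_one hc, one_mul]

theorem placeProd_le_placeProd {x : ι → K} {y : ι' → K} (hx : x ≠ 0) (hy : y ≠ 0)
    (harch : ∀ v : InfinitePlace K, archNorm v x ≤ archNorm v y)
    (hfin : ∀ v : FinitePlace K, ⨆ i, v (x i) ≤ ⨆ i, v (y i)) :
    placeProd K x ≤ placeProd K y := by
  refine mul_le_mul (Finset.prod_le_prod (fun v _ => pow_nonneg (archNorm_nonneg v x) _)
    fun v _ => pow_le_pow_left₀ (archNorm_nonneg v x) (harch v) _) ?_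
    (finprod_nonneg fun v => iSup_finitePlace_nonneg v x)
    (Finset.prod_nonneg fun v _ => pow_nonneg (archNorm_nonneg v y) _)
  exact finprod_le_finprod (hasFiniteMulSupport_iSup_finitePlace hx)
    (fun v => iSup_finitePlace_nonneg v x) (hasFiniteMulSupport_iSup_finitePlace hy) hfin

theorem heightOver_le_heightOver {x : ι → K} {y : ι' → K} (h : placeProd K x ≤ placeProd K y) :
    heightOver K x ≤ heightOver K y :=
  Real.rpow_le_rpow (placeProd_nonneg x) h (by positivity)

/-- Dropping coordinates decreases every local norm. Injectivity of `e` matters for the Euclidean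
norms, where a repeated coordinate would count twice. -/
theorem heightOver_comp_le {x : ι → K} (hx : x ≠ 0) (y : ι' → K) {e : ι → ι'}
    (he : Function.Injective e) (hxy : ∀ i, x i = y (e i)) : heightOver K x ≤ heightOver K y := by
  obtain ⟨j, hj⟩ := Function.ne_iff.mp hx
  have : Nonempty ι := ⟨j⟩
  have hy : y ≠ 0 := fun h => hj (by simp [hxy, h])
  refine heightOver_le_heightOver (placeProd_le_placeProd hx hy (fun v => ?_) fun v => ?_)
  · refine Real.sqrt_le_sqrt ?_
    simp only [hxy]
    exact (Finset.sum_map Finset.univ ⟨e, he⟩ fun i => v (y i) ^ 2).symm.trans_le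
      (Finset.sum_le_sum_of_subset_of_nonneg (Finset.subset_univ _) fun _ _ _ => by positivity)
  · refine ciSup_le fun i => ?_
    rw [hxy]
    exact le_iSup_finitePlace v y (e i)

theorem heightOver_comp_bijective {x : ι → K} (hx : x ≠ 0) (y : ι' → K) {e : ι → ι'}
    (he : Function.Bijective e) (hxy : ∀ i, x i = y (e i)) : heightOver K x = heightOver K y := by
  obtain ⟨j, hj⟩ := Function.ne_iff.mp hx
  have hy : y ≠ 0 := fun h => hj (by simp [hxy, h])
  refine (heightOver_comp_le hx y he.1 hxy).antisymm
    (heightOver_comp_le hy x (Equiv.ofBijective e he).symm.injective fun i => ?_)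
  rw [hxy]
  exact congrArg y ((Equiv.ofBijective e he).apply_symm_apply i).symm

theorem placeProd_eq_one_of_unique [Unique ι] {x : ι → K} (hx : x ≠ 0) : placeProd K x = 1 := by
  have hd : x default ≠ 0 := fun h => hx (funext fun i => by rw [Unique.eq_default i, h]; rfl)
  have h1 (v : InfinitePlace K) : archNorm v x = v (x default) := by
    simp [archNorm, Real.sqrt_sq]
  simp only [placeProd, h1, ciSup_unique]
  exact prod_abs_eq_one hd

/-- A single nonzero coordinate already has height 1, by the product formula. -/
theorem one_le_heightOver {x : ι → K} (hx : x ≠ 0) : 1 ≤ heightOver K x := by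
  obtain ⟨j, hj⟩ := Function.ne_iff.mp hx
  have hu : (fun _ : Unit => x j) ≠ 0 := fun h => hj (congrFun h ())
  have h := heightOver_comp_le hu x (e := fun _ => j) (fun _ _ _ => rfl) fun _ => rfl
  rwa [heightOver_eq, placeProd_eq_one_of_unique hu, Real.one_rpow] at h

end PlaceProduct

/-! ### Invariance of the height under extension of the number field -/

section Extension

variable {K L : Type*} [Field K] [NumberField K] [Field L] [NumberField L] [Algebra K L]
  {ι : Type*} [Fintype ι]

/-- The multiplicity of a place is the number of embeddings inducing it, so weighted products over
places become plain products over embeddings, which are easier to follow in extensions. -/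
theorem prod_infinitePlace_pow_mult (g : (K →+* ℂ) → ℝ) (f : InfinitePlace K → ℝ)
    (h : ∀ φ, g φ = f (.mk φ)) : ∏ v, f v ^ v.mult = ∏ φ : K →+* ℂ, g φ := by
  classical
  rw [← Finset.prod_fiberwise Finset.univ InfinitePlace.mk g]
  refine Finset.prod_congr rfl fun v _ => ?_
  have (φ) (hφ : φ ∈ ({φ | InfinitePlace.mk φ = v} : Finset (K →+* ℂ))) : g φ = f v := by
    rw [h, (Finset.mem_filter.mp hφ).2]
  rw [Finset.prod_congr rfl this, Finset.prod_const, InfinitePlace.card_filter_mk_eq]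

theorem card_embeddings_extending (φ : K →+* ℂ) [DecidableEq (K →+* ℂ)] :
    (Finset.univ.filter fun ψ : L →+* ℂ => ψ.comp (algebraMap K L) = φ).card =
      Module.finrank K L := by
  have : Module.Finite K L := Module.Finite.of_restrictScalars_finite ℚ K L
  let := φ.toAlgebra
  rw [← AlgHom.card K L ℂ, ← Fintype.card_subtype]
  refine Fintype.card_congr
    ⟨fun ψ => ⟨ψ.1, fun x => RingHom.congr_fun ψ.2 x⟩,
      fun ψ => ⟨ψ.toRingHom, RingHom.ext fun x => ψ.commutes x⟩, fun _ => rfl, fun _ => rfl⟩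

theorem prod_archNorm_algebraMap (x : ι → K) :
    ∏ w : InfinitePlace L, archNorm w (fun i => algebraMap K L (x i)) ^ w.mult =
      (∏ v : InfinitePlace K, archNorm v x ^ v.mult) ^ Module.finrank K L := by
  classical
  rw [prod_infinitePlace_pow_mult (K := K) (fun φ => Real.sqrt (∑ i, ‖φ (x i)‖ ^ 2))
      (fun v => archNorm v x) fun φ => rfl,
    prod_infinitePlace_pow_mult (K := L)
      (fun ψ => Real.sqrt (∑ i, ‖ψ (algebraMap K L (x i))‖ ^ 2))
      (fun w => archNorm w (fun i => algebraMap K L (x i))) fun ψ => rfl,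
    ← Finset.prod_pow,
    ← Finset.prod_fiberwise Finset.univ fun ψ : L →+* ℂ => ψ.comp (algebraMap K L)]
  refine Finset.prod_congr rfl fun φ _ => ?_
  rw [← card_embeddings_extending (L := L) φ, ← Finset.prod_const]
  refine Finset.prod_congr rfl fun ψ hψ => ?_
  rw [← (Finset.mem_filter.mp hψ).2]
  rfl

/-- For integral coordinates the finite part is the inverse of the norm of the ideal they generate,
and extending an ideal to L raises its norm to the power [L : K]. -/
theorem finprod_finitePlace_algebraMap_of_integral {x : ι → 𝓞 K} (hx : x ≠ 0) :
    ∏ᶠ w : FinitePlace L, ⨆ i, w (algebraMap K L (x i)) =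
      (∏ᶠ v : FinitePlace K, ⨆ i, v (x i)) ^ Module.finrank K L := by
  have hy : (fun i => algebraMap (𝓞 K) (𝓞 L) (x i)) ≠ 0 := by
    obtain ⟨j, hj⟩ := Function.ne_iff.mp hx
    refine Function.ne_iff.mpr ⟨j, ?_⟩
    simpa using hj
  have hL := absNorm_mul_finprod_finitePlace_eq_one hy
  have hspan : Ideal.span (Set.range fun i => algebraMap (𝓞 K) (𝓞 L) (x i)) =
      (Ideal.span (Set.range x)).map (algebraMap (𝓞 K) (𝓞 L)) := by
    rw [Ideal.map_span, ← Set.range_comp]; rfl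
  rw [hspan, Ideal.absNorm_algebraMap, ← IsFractionRing.finrank_eq (𝓞 K) K (𝓞 L) L,
    Nat.cast_pow] at hL
  have hK := congrArg (· ^ Module.finrank K L) (absNorm_mul_finprod_finitePlace_eq_one hx)
  simp only [mul_pow, one_pow] at hK
  have h0 : ((Ideal.span (Set.range x)).absNorm : ℝ) ^ Module.finrank K L ≠ 0 :=
    left_ne_zero_of_mul_eq_one hK
  exact mul_left_cancel₀ h0 (hL.trans hK.symm)

theorem placeProd_algebraMap {x : ι → K} (hx : x ≠ 0) :
    placeProd L (fun i => algebraMap K L (x i)) = placeProd K x ^ Module.finrank K L := by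
  -- Clearing denominators reduces to the integral case; the common denominator is a scalar that
  -- leaves `placeProd` unchanged.
  obtain ⟨b, hb⟩ := IsLocalization.exist_integer_multiples_of_finite (nonZeroDivisors (𝓞 K)) x
  choose y hy using hb
  have hb1 : ((b : 𝓞 K) : K) ≠ 0 := by simp
  have hyx : (fun i => (y i : K)) = ((b : 𝓞 K) : K) • x := by
    funext i
    exact (hy i).trans (Algebra.smul_def _ _)
  have hx' : ((b : 𝓞 K) : K) • x ≠ 0 := smul_ne_zero hb1 hx
  have hy0 : y ≠ 0 := by
    rintro rfl
    exact hx' (hyx ▸ by funext i; simp)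
  have key : placeProd L (fun i => algebraMap K L (y i)) =
      placeProd K (fun i => (y i : K)) ^ Module.finrank K L := by
    rw [placeProd, placeProd, prod_archNorm_algebraMap,
      finprod_finitePlace_algebraMap_of_integral hy0, mul_pow]
  have hL : (fun i => algebraMap K L (y i)) =
      algebraMap K L ((b : 𝓞 K) : K) • fun i => algebraMap K L (x i) := by
    funext i
    simpa using congrArg (algebraMap K L) (congrFun hyx i)
  have hxL : (fun i => algebraMap K L (x i)) ≠ 0 := by
    obtain ⟨j, hj⟩ := Function.ne_iff.mp hx
    exact Function.ne_iff.mpr ⟨j, by simp at hj ⊢; exact hj⟩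
  rw [hL, hyx, placeProd_smul (by simp) hxL, placeProd_smul hb1 hx] at key
  exact key

theorem heightOver_algebraMap {x : ι → K} (hx : x ≠ 0) :
    heightOver L (fun i => algebraMap K L (x i)) = heightOver K x := by
  have : Module.Finite K L := Module.Finite.of_restrictScalars_finite ℚ K L
  have hKL : (Module.finrank K L : ℝ) ≠ 0 := by exact_mod_cast Module.finrank_pos.ne'
  rw [heightOver_eq, heightOver_eq, placeProd_algebraMap hx, ← Real.rpow_natCast,
    ← Real.rpow_mul (placeProd_nonneg x), ← Module.finrank_mul_finrank ℚ K L]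
  congr 1
  push_cast
  field_simp

end Extension

/-- The field E generated by the coordinates lies in the image of φ, so inverting φ makes L an
extension of E, and invariance applies. -/
theorem absHeight_eq_heightOver {Qbar : Type*} [Field Qbar] [Algebra ℚ Qbar]
    [IsAlgClosure ℚ Qbar] {L : Type*} [Field L] [NumberField L] (φ : L →+* Qbar)
    {ι : Type*} [Fintype ι] {y : ι → L} (hy : y ≠ 0) :
    absHeight (fun i => φ (y i)) = heightOver L y := by
  let := numberField_adjoin_range fun i => φ (y i)
  let E := IntermediateField.adjoin ℚ (Set.range fun i => φ (y i))
  let e : L ≃+* φ.fieldRange :=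
    RingEquiv.ofBijective φ.rangeRestrictField φ.rangeRestrictField_bijective
  have hle (z : E) : (z : Qbar) ∈ φ.fieldRange := by
    have : E ≤ φ.toRatAlgHom.fieldRange :=
      IntermediateField.adjoin_le_iff.mpr (by rintro _ ⟨i, rfl⟩; exact ⟨y i, rfl⟩)
    exact this z.2
  let : Algebra E L := (e.symm.toRingHom.comp
    ((algebraMap E Qbar).codRestrict φ.fieldRange.toSubring hle)).toAlgebra
  have hmap (i : ι) : algebraMap E L
      ⟨φ (y i), IntermediateField.subset_adjoin ℚ _ ⟨i, rfl⟩⟩ = y i := by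
    change e.symm _ = y i
    rw [RingEquiv.symm_apply_eq]
    exact Subtype.ext rfl
  unfold absHeight
  rw [← heightOver_algebraMap (L := L)]
  · exact congrArg (heightOver L) (funext hmap)
  · obtain ⟨j, hj⟩ := Function.ne_iff.mp hy
    refine Function.ne_iff.mpr ⟨j, fun h => hj ?_⟩
    rw [← hmap j, h]
    exact map_zero _

/-! ### Heights of the roots against the height of the polynomial -/

section BinaryForms

variable {L : Type*} [Field L] [NumberField L]

theorem sqrt_sq_add_one_le (t : ℝ) (ht : 0 ≤ t) :
    Real.sqrt (t ^ 2 + 1) ≤ Real.sqrt 2 * max 1 t := by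
  rw [← Real.sqrt_sq (le_max_of_le_left zero_le_one : (0 : ℝ) ≤ max 1 t),
    ← Real.sqrt_mul zero_le_two]
  refine Real.sqrt_le_sqrt ?_
  have h1 : 1 ≤ max 1 t := le_max_left _ _
  have h2 : t ≤ max 1 t := le_max_right _ _
  nlinarith

/-- The Mahler measure |a| ∏ max(1, |α_i|) mediates: each factor on the left loses at most √2, and
Landau's inequality bounds the measure by the ℓ² norm of the coefficients. -/
theorem prod_sqrt_sq_add_one_le {M : ℕ} (a : ℂ) (ha : a ≠ 0) (α : Fin M → ℂ)
    (f : Polynomial ℂ) (hf : f = Polynomial.C a * ∏ i, (Polynomial.X - Polynomial.C (α i))) :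
    ‖a‖ * ∏ i, Real.sqrt (‖α i‖ ^ 2 + 1) ≤
      Real.sqrt 2 ^ M * Real.sqrt (∑ j ∈ f.support, ‖f.coeff j‖ ^ 2) := by
  have hm : f.mahlerMeasure = ‖a‖ * ∏ i, max 1 ‖α i‖ := by
    rw [hf, Polynomial.mahlerMeasure_mul, Polynomial.mahlerMeasure_const]
    congr 1
    clear hf
    induction M with
    | zero => simp
    | succ k ih =>
      rw [Fin.prod_univ_succ, Fin.prod_univ_succ, Polynomial.mahlerMeasure_mul,
        Polynomial.mahlerMeasure_X_sub_C, ih fun i => α i.succ]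
  calc ‖a‖ * ∏ i, Real.sqrt (‖α i‖ ^ 2 + 1)
      ≤ ‖a‖ * ∏ i, (Real.sqrt 2 * max 1 ‖α i‖) := by
        gcongr with i
        exact sqrt_sq_add_one_le _ (norm_nonneg _)
    _ = Real.sqrt 2 ^ M * f.mahlerMeasure := by
        rw [hm, Finset.prod_mul_distrib, Finset.prod_const, Finset.card_univ, Fintype.card_fin]
        ring
    _ ≤ _ := by gcongr; exact f.mahlerMeasure_le_sqrt_sum_sq_norm_coeff

-- Gauss's lemma: the Gauss norm at a non-archimedean absolute value is multiplicative, so it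
-- suffices to compute it on linear factors.
omit [NumberField L] in
theorem gaussNorm_C_mul_prod_X_sub_C {v : AbsoluteValue L ℝ} (hv : IsNonarchimedean v) {M : ℕ}
    (a : L) (α : Fin M → L) :
    (Polynomial.C a * ∏ i, (Polynomial.X - Polynomial.C (α i))).gaussNorm v 1 =
      v a * ∏ i, max (v (α i)) 1 := by
  have hX (b : L) : (Polynomial.X - Polynomial.C b).gaussNorm v 1 = max (v b) 1 := by
    refine le_antisymm ?_ (max_le ?_ ?_)
    · obtain ⟨i, hi⟩ := Polynomial.exists_eq_gaussNorm v 1 (Polynomial.X - Polynomial.C b)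
      rw [hi, one_pow, mul_one, Polynomial.coeff_sub, Polynomial.coeff_X, Polynomial.coeff_C]
      rcases i with _ | _ | i <;> simp
    · have h := (Polynomial.X - Polynomial.C b).le_gaussNorm v zero_le_one 0
      rwa [Polynomial.coeff_sub, Polynomial.coeff_X_zero, Polynomial.coeff_C_zero, zero_sub,
        v.map_neg, pow_zero, mul_one] at h
    · have h := (Polynomial.X - Polynomial.C b).le_gaussNorm v zero_le_one 1
      rwa [Polynomial.coeff_sub, Polynomial.coeff_X_one, Polynomial.coeff_C_succ, sub_zero,
        v.map_one, pow_one, mul_one] at h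
  rw [Polynomial.gaussNorm_mul hv one_pos, Polynomial.gaussNorm_C]
  congr 1
  induction M with
  | zero =>
    simpa using Polynomial.gaussNorm_C v 1 (1 : L)
  | succ k ih =>
    rw [Fin.prod_univ_succ, Fin.prod_univ_succ, Polynomial.gaussNorm_mul hv one_pos, hX, ih]

omit [NumberField L] in
theorem iSup_coeff_eq_gaussNorm (v : AbsoluteValue L ℝ) (f : Polynomial L) :
    ⨆ j : f.support, v (f.coeff j) = f.gaussNorm v 1 := by
  rcases eq_or_ne f 0 with rfl | hf
  · simp
  · have : Nonempty f.support := (Polynomial.nonempty_support_iff.mpr hf).to_subtype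
    refine le_antisymm (ciSup_le fun j => ?_) ?_
    · simpa using f.le_gaussNorm v zero_le_one j
    · obtain ⟨i, hi⟩ := Polynomial.exists_eq_gaussNorm v 1 f
      rw [hi, one_pow, mul_one]
      by_cases h : f.coeff i = 0
      · rw [h, map_zero]
        exact Real.iSup_nonneg fun _ => v.nonneg _
      · exact Finite.le_ciSup (fun j : f.support => v (f.coeff j))
          ⟨i, Polynomial.mem_support_iff.mpr h⟩

/-- The vector of length `k + 2` with coordinates `a, 1, 0, …, 0`. -/
def affinePoint {R : Type*} [Zero R] [One R] (k : ℕ) (a : R) : Fin (k + 2) → R :=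
  Fin.cons a (Fin.cons 1 0)

theorem affinePoint_ne_zero {R : Type*} [Zero R] [One R] [NeZero (1 : R)] (k : ℕ) (a : R) :
    affinePoint k a ≠ 0 :=
  Function.ne_iff.mpr ⟨1, by simp [affinePoint, Fin.cons_one]⟩

omit [NumberField L] in
theorem archNorm_affinePoint (v : InfinitePlace L) (k : ℕ) (a : L) :
    archNorm v (affinePoint k a) = Real.sqrt (v a ^ 2 + 1) := by
  simp [archNorm, affinePoint, Fin.sum_univ_succ]

theorem iSup_affinePoint (v : FinitePlace L) (k : ℕ) (a : L) :
    ⨆ i, v (affinePoint k a i) = max (v a) 1 := by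
  refine le_antisymm (ciSup_le fun i => ?_) (max_le ?_ ?_)
  · refine Fin.cases (by simp [affinePoint]) (fun i => ?_) i
    refine Fin.cases (by simp [affinePoint]) (fun i => ?_) i
    simp [affinePoint]
  · exact le_iSup_finitePlace v (affinePoint k a) 0
  · simpa [affinePoint] using le_iSup_finitePlace v (affinePoint k a) 1

theorem prod_placeProd_affinePoint_le (k : ℕ) {M : ℕ} {a : L} (ha : a ≠ 0) (α : Fin M → L)
    {f : Polynomial L} (hf : f = Polynomial.C a * ∏ i, (Polynomial.X - Polynomial.C (α i))) :
    ∏ i, placeProd L (affinePoint k (α i)) ≤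
      (Real.sqrt 2 ^ M) ^ Module.finrank ℚ L *
        placeProd L (fun j : f.support => f.coeff j) := by
  have hf0 : f ≠ 0 := by
    rw [hf]
    exact mul_ne_zero (by simpa using ha)
      (Finset.prod_ne_zero_iff.mpr fun i _ => Polynomial.X_sub_C_ne_zero _)
  have harch (v : InfinitePlace L) : v a * ∏ i, archNorm v (affinePoint k (α i)) ≤
      Real.sqrt 2 ^ M * archNorm v (fun j : f.support => f.coeff j) := by
    have h := prod_sqrt_sq_add_one_le (v.embedding a) (by simpa using ha)
      (fun i => v.embedding (α i)) (f.map v.embedding)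
      (by rw [hf]; simp [Polynomial.map_prod])
    simp only [Polynomial.coeff_map, InfinitePlace.norm_embedding_eq,
      Polynomial.support_map_of_injective f v.embedding.injective] at h
    simp only [archNorm_affinePoint]
    rw [archNorm, Finset.sum_coe_sort f.support fun j => v (f.coeff j) ^ 2]
    exact h
  have hfin (v : FinitePlace L) : v a * ∏ i, ⨆ l, v (affinePoint k (α i) l) =
      ⨆ j : f.support, v (f.coeff j) := by
    simp only [iSup_affinePoint]
    have hna : IsNonarchimedean v.1 := FinitePlace.add_le v
    have h := gaussNorm_C_mul_prod_X_sub_C hna a α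
    rw [← hf, ← iSup_coeff_eq_gaussNorm] at h
    exact h.symm
  have hsupp (i : Fin M) := hasFiniteMulSupport_iSup_finitePlace (affinePoint_ne_zero k (α i))
  -- The local estimates carry a factor `v a` at every place; over all places these factors cancel
  -- by the product formula.
  have hprod : (∏ᶠ v : FinitePlace L, v a) *
      ∏ i, ∏ᶠ v : FinitePlace L, ⨆ l, v (affinePoint k (α i) l) =
      ∏ᶠ v : FinitePlace L, ⨆ j : f.support, v (f.coeff j) := by
    rw [← finprod_prod_comm _ _ fun i _ => hsupp i,
      ← finprod_mul_distrib (FinitePlace.hasFiniteMulSupport ha) (.prod hsupp Finset.univ)]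
    exact finprod_congr hfin
  have hexp : (Real.sqrt 2 ^ M) ^ Module.finrank ℚ L =
      ∏ v : InfinitePlace L, (Real.sqrt 2 ^ M) ^ v.mult := by
    rw [Finset.prod_pow_eq_pow_sum, InfinitePlace.sum_mult_eq]
  have hA : ∏ v : InfinitePlace L, (v a * ∏ i, archNorm v (affinePoint k (α i))) ^ v.mult ≤
      (Real.sqrt 2 ^ M) ^ Module.finrank ℚ L *
        ∏ v : InfinitePlace L, archNorm v (fun j : f.support => f.coeff j) ^ v.mult := by
    rw [hexp, ← Finset.prod_mul_distrib]
    refine Finset.prod_le_prod (fun v _ => ?_) fun v _ => ?_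
    · exact pow_nonneg (mul_nonneg (apply_nonneg v a)
        (Finset.prod_nonneg fun i _ => archNorm_nonneg v _)) _
    · rw [← mul_pow]
      exact pow_le_pow_left₀ (mul_nonneg (apply_nonneg v a)
        (Finset.prod_nonneg fun i _ => archNorm_nonneg v _)) (harch v) _
  have hP : ∏ i, placeProd L (affinePoint k (α i)) =
      (∏ v : InfinitePlace L, (v a * ∏ i, archNorm v (affinePoint k (α i))) ^ v.mult) *
        ∏ᶠ v : FinitePlace L, ⨆ j : f.support, v (f.coeff j) := by
    simp only [placeProd, mul_pow, Finset.prod_mul_distrib, ← Finset.prod_pow]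
    rw [← hprod, mul_mul_mul_comm, prod_abs_eq_one ha, one_mul, Finset.prod_comm]
  rw [hP, placeProd, ← mul_assoc]
  exact mul_le_mul_of_nonneg_right hA
    (finprod_nonneg fun v => iSup_finitePlace_nonneg v fun j : f.support => f.coeff j)

theorem prod_heightOver_affinePoint_le (k : ℕ) {M : ℕ} {a : L} (ha : a ≠ 0) (α : Fin M → L)
    {f : Polynomial L} (hf : f = Polynomial.C a * ∏ i, (Polynomial.X - Polynomial.C (α i))) :
    ∏ i, heightOver L (affinePoint k (α i)) ≤
      Real.sqrt 2 ^ M * heightOver L (fun j : f.support => f.coeff j) := by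
  have hd : Module.finrank ℚ L ≠ 0 := Module.finrank_pos.ne'
  refine le_of_pow_le_pow_left₀ hd (mul_nonneg (by positivity) (heightOver_nonneg _)) ?_
  rw [mul_pow, ← Finset.prod_pow]
  simp only [heightOver_pow_finrank]
  exact prod_placeProd_affinePoint_le k ha α hf

theorem exists_heightOver_affinePoint_le (k : ℕ) {M : ℕ} (hM : M ≠ 0) {f : Polynomial L}
    (hf : f.Splits) (hdeg : f.natDegree = M) :
    ∃ a : L, f.eval a = 0 ∧ heightOver L (affinePoint k a) ≤
      Real.sqrt 2 * heightOver L (fun j : f.support => f.coeff j) ^ (1 / (M : ℝ)) := by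
  have hf0 : f ≠ 0 := by rintro rfl; simp at hdeg; exact hM hdeg.symm
  obtain ⟨α, hroot, hfac⟩ : ∃ α : Fin M → L, (∀ i, f.eval (α i) = 0) ∧
      f = Polynomial.C f.leadingCoeff * ∏ i, (Polynomial.X - Polynomial.C (α i)) := by
    have hcard : f.roots.toList.length = M := by
      rw [Multiset.length_toList, ← hdeg, hf.natDegree_eq_card_roots]
    clear hdeg
    subst hcard
    refine ⟨fun i => f.roots.toList[i.1], fun i => ?_, ?_⟩
    · exact (Polynomial.mem_roots hf0).mp (Multiset.mem_toList.mp (List.getElem_mem _))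
    · conv_lhs => rw [hf.eq_prod_roots]
      rw [Fin.prod_univ_fun_getElem f.roots.toList fun x => Polynomial.X - Polynomial.C x,
        ← Multiset.prod_coe, ← Multiset.map_coe, Multiset.coe_toList]
  have hle := prod_heightOver_affinePoint_le k (Polynomial.leadingCoeff_ne_zero.mpr hf0) α hfac
  set B := heightOver L (fun j : f.support => f.coeff j)
  have hB : 0 ≤ B := heightOver_nonneg _
  -- If every root exceeded the bound, the product of the M heights would exceed its M-th power;
  -- strictness needs M > 0 and `B` > 0.
  by_contra! hlt
  refine absurd hle (not_le.mpr ?_)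
  have hpow : Real.sqrt 2 ^ M * B = ∏ _i : Fin M, (Real.sqrt 2 * B ^ (1 / (M : ℝ))) := by
    rw [Finset.prod_const, Finset.card_univ, Fintype.card_fin, mul_pow, one_div,
      Real.rpow_inv_natCast_pow hB hM]
  have hBpos : 0 < B := zero_lt_one.trans_le (one_le_heightOver (Function.ne_iff.mpr
    ⟨⟨M, by simp [← hdeg, hf0]⟩, by simp [← hdeg, hf0]⟩))
  have : Nonempty (Fin M) := ⟨⟨0, Nat.pos_of_ne_zero hM⟩⟩
  rw [hpow]
  exact Finset.prod_lt_prod_of_nonempty (fun i _ => by positivity)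
    (fun i _ => hlt (α i) (hroot i)) Finset.univ_nonempty

end BinaryForms

/-! ### Restriction of a form to the points (X, 1, 0, ..., 0) -/

section Dehomogenize

variable {K : Type*} [Field K]

/-- The dehomogenization of a form after restriction to the first two variables. -/
noncomputable def dehomogenize {k : ℕ} (F : MvPolynomial (Fin (k + 2)) K) : Polynomial K :=
  MvPolynomial.aeval (affinePoint k (Polynomial.X : Polynomial K)) F

theorem aeval_dehomogenize {k : ℕ} (F : MvPolynomial (Fin (k + 2)) K) {A : Type*} [CommRing A]
    [Algebra K A] (a : A) :
    Polynomial.aeval a (dehomogenize F) = MvPolynomial.aeval (affinePoint k a) F := by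
  rw [dehomogenize, MvPolynomial.comp_aeval_apply]
  congr 2
  funext i
  refine Fin.cases (by simp [affinePoint]) (fun i => ?_) i
  refine Fin.cases (by simp [affinePoint]) (fun i => ?_) i
  simp [affinePoint]

theorem coeff_dehomogenize {k : ℕ} (F : MvPolynomial (Fin (k + 2)) K) (j : ℕ) :
    (dehomogenize F).coeff j =
      ∑ m ∈ F.support, if m 0 = j ∧ ∀ i : Fin k, m i.succ.succ = 0 then F.coeff m else 0 := by
  rw [dehomogenize, MvPolynomial.aeval_def, MvPolynomial.eval₂_eq', Polynomial.finsetSum_coeff]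
  refine Finset.sum_congr rfl fun m _ => ?_
  have h : ∏ i, affinePoint k (Polynomial.X : Polynomial K) i ^ m i =
      if ∀ i : Fin k, m i.succ.succ = 0 then Polynomial.X ^ m 0 else 0 := by
    rw [Fin.prod_univ_succ, Fin.prod_univ_succ]
    split_ifs with h0
    · simp [affinePoint, h0]
    · obtain ⟨i, hi⟩ := not_forall.mp h0
      rw [Finset.prod_eq_zero (Finset.mem_univ i) (by simp [affinePoint, hi])]
      simp
  rw [h, Polynomial.algebraMap_eq, Polynomial.coeff_C_mul]
  by_cases h0 : ∀ i : Fin k, m i.succ.succ = 0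
  · simp [h0, Polynomial.coeff_X_pow, eq_comm]
  · simp [h0]

theorem eq_single_add_single {k M j : ℕ} {m : Fin (k + 2) →₀ ℕ} (hm : m.degree = M)
    (hj : m 0 = j) (h : ∀ i : Fin k, m i.succ.succ = 0) :
    j ≤ M ∧ m = Finsupp.single 0 j + Finsupp.single 1 (M - j) := by
  rw [Finsupp.degree_eq_sum, Fin.sum_univ_succ, Fin.sum_univ_succ,
    Finset.sum_eq_zero fun i _ => h i] at hm
  have h1 : m 1 = M - j := by
    have : m (Fin.succ 0) = m 1 := rfl
    omega
  refine ⟨by omega, Finsupp.ext fun i => ?_⟩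
  refine Fin.cases (by simp [hj]) (fun i => ?_) i
  refine Fin.cases ?_ (fun i => ?_) i
  · simp [h1]
  · simp [h, Fin.ext_iff]

theorem coeff_dehomogenize_of_isHomogeneous {k M : ℕ} {F : MvPolynomial (Fin (k + 2)) K}
    (hF : F.IsHomogeneous M) (j : ℕ) :
    (dehomogenize F).coeff j = F.coeff (Finsupp.single 0 j + Finsupp.single 1 (M - j)) := by
  rw [coeff_dehomogenize, Finset.sum_eq_single (Finsupp.single 0 j + Finsupp.single 1 (M - j))]
  · rw [if_pos]
    refine ⟨by simp, fun i => by simp [Fin.ext_iff]⟩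
  · intro m hm hne
    refine if_neg fun h => hne (eq_single_add_single ?_ h.1 h.2).2
    rw [Finsupp.degree_eq_weight_one]
    exact hF (MvPolynomial.mem_support_iff.mp hm)
  · intro hm
    rw [MvPolynomial.notMem_support_iff.mp hm, ite_self]

theorem coeff_dehomogenize_of_lt {k M : ℕ} {F : MvPolynomial (Fin (k + 2)) K}
    (hF : F.IsHomogeneous M) {j : ℕ} (hj : M < j) : (dehomogenize F).coeff j = 0 := by
  rw [coeff_dehomogenize]
  refine Finset.sum_eq_zero fun m hm => if_neg fun h => ?_
  refine hj.not_ge (eq_single_add_single ?_ h.1 h.2).1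
  rw [Finsupp.degree_eq_weight_one]
  exact hF (MvPolynomial.mem_support_iff.mp hm)

theorem heightOver_coeff_le_polyHeight [NumberField K] {σ : Type*} {F : MvPolynomial σ K}
    {f : Polynomial K} (h0 : f ≠ 0) (e : ℕ → σ →₀ ℕ) (he : Function.Injective e)
    (h : ∀ j ∈ f.support, f.coeff j = F.coeff (e j)) :
    heightOver K (fun j : f.support => f.coeff j) ≤ polyHeight F := by
  have hx : (fun j : f.support => f.coeff j) ≠ 0 := by
    obtain ⟨j, hj⟩ := Polynomial.nonempty_support_iff.mpr h0
    exact Function.ne_iff.mpr ⟨⟨j, hj⟩, Polynomial.mem_support_iff.mp hj⟩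
  have hmem (j : f.support) : e j ∈ F.support := by
    rw [MvPolynomial.mem_support_iff, ← h j j.2]
    exact Polynomial.mem_support_iff.mp j.2
  let e' : f.support → F.support := fun j => ⟨e j, hmem j⟩
  have he' : Function.Injective e' := fun i j hij => Subtype.ext (he (Subtype.mk.inj hij))
  have key := @heightOver_comp_le K _ _ f.support F.support _ _ (fun j => f.coeff j) hx
    (fun m => F.coeff m) e'
  exact key he' fun j => h j j.2

theorem heightOver_dehomogenize_le [NumberField K] {k M : ℕ} {F : MvPolynomial (Fin (k + 2)) K}
    (hF : F.IsHomogeneous M) (h0 : dehomogenize F ≠ 0) :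
    heightOver K (fun j : (dehomogenize F).support => (dehomogenize F).coeff j) ≤
      polyHeight F := by
  refine heightOver_coeff_le_polyHeight h0
    -- Although `M - j` is truncated for j > M, the first exponent still recovers j, so the map is
    -- injective on all of ℕ.
    (fun j => Finsupp.single 0 j + Finsupp.single 1 (M - j)) (fun i j hij => ?_)
    fun j _ => coeff_dehomogenize_of_isHomogeneous hF j
  simpa using DFunLike.congr_fun hij 0

end Dehomogenize

theorem one_le_polyHeight {K : Type*} [Field K] [NumberField K] {σ : Type*}
    {F : MvPolynomial σ K} (hF : F ≠ 0) : 1 ≤ polyHeight F := by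
  refine one_le_heightOver ?_
  obtain ⟨m, hm⟩ := MvPolynomial.support_nonempty.mpr hF
  exact Function.ne_iff.mpr ⟨⟨m, hm⟩, MvPolynomial.mem_support_iff.mp hm⟩

/-! ### Existence of small zeros of bounded degree -/

section SmallZeros

variable {K : Type*} [Field K] [NumberField K] {Qbar : Type*} [Field Qbar] [Algebra ℚ Qbar]
  [IsAlgClosure ℚ Qbar] [Algebra K Qbar]

theorem heightOver_single_one {ι : Type*} [Fintype ι] [DecidableEq ι] (i : ι) :
    heightOver K (Pi.single i 1 : ι → K) = 1 := by
  have hne : (Pi.single i 1 : ι → K) ≠ 0 := by simp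
  have h1 : placeProd K (Pi.single i 1 : ι → K) = placeProd K (fun _ : Unit => (1 : K)) := by
    have hA (v : InfinitePlace K) (j : ι) : v ((Pi.single i 1 : ι → K) j) ^ 2 =
        if j = i then 1 else 0 := by
      rcases eq_or_ne j i with rfl | h <;> simp [*]
    have hB (v : FinitePlace K) : ⨆ j, v ((Pi.single i 1 : ι → K) j) = 1 := by
      have : Nonempty ι := ⟨i⟩
      refine le_antisymm (ciSup_le fun j => ?_) ?_
      · rcases eq_or_ne j i with rfl | h <;> simp [*]
      · simpa using le_iSup_finitePlace v (Pi.single i 1 : ι → K) i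
    simp [placeProd, archNorm, hA, hB]
  rw [heightOver_eq, h1, placeProd_eq_one_of_unique (Function.ne_iff.mpr ⟨(), one_ne_zero⟩),
    Real.one_rpow]

omit [NumberField K] [Algebra ℚ Qbar] [IsAlgClosure ℚ Qbar] in
theorem degOver_le_of_aeval_eq_zero {ι : Type*} {z : ι → Qbar} {f : Polynomial K} (hf : f ≠ 0)
    {a : Qbar} (ha : Polynomial.aeval a f = 0)
    (hz : ∀ i, z i ∈ IntermediateField.adjoin K {a}) : degOver K z ≤ f.natDegree := by
  have hint : IsIntegral K a := isAlgebraic_iff_isIntegral.mp ⟨f, hf, ha⟩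
  have : FiniteDimensional K (IntermediateField.adjoin K {a}) :=
    IntermediateField.adjoin.finiteDimensional hint
  have hle : IntermediateField.adjoin K (Set.range z) ≤ IntermediateField.adjoin K {a} :=
    IntermediateField.adjoin_le_iff.mpr (by rintro _ ⟨i, rfl⟩; exact hz i)
  calc degOver K z ≤ Module.finrank K (IntermediateField.adjoin K {a}) :=
        LinearMap.finrank_le_finrank_of_injective
          (f := (IntermediateField.inclusion hle).toLinearMap)
          (IntermediateField.inclusion_injective hle)
    _ = (minpoly K a).natDegree := IntermediateField.adjoin.finrank hint
    _ ≤ f.natDegree := Polynomial.natDegree_le_of_dvd (minpoly.dvd K a ha) hf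

theorem exists_small_zero_of_coeff_eq_zero {k M : ℕ} (hM : 1 ≤ M)
    {F : MvPolynomial (Fin (k + 2)) K} (hF : F.IsHomogeneous M) (hF0 : F ≠ 0)
    (h : F.coeff (Finsupp.single 0 M) = 0) :
    ∃ z : Fin (k + 2) → Qbar, z ≠ 0 ∧ degOver K z ≤ M ∧ MvPolynomial.aeval z F = 0 ∧
      absHeight z ≤ Real.sqrt 2 * polyHeight F ^ (1 / (M : ℝ)) := by
  refine ⟨Pi.single 0 1, by simp, ?_, ?_, ?_⟩
  · have h1 := degOver_le_of_aeval_eq_zero (K := K) (z := (Pi.single 0 1 : Fin (k + 2) → Qbar))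
      (f := Polynomial.X) Polynomial.X_ne_zero (a := 0) (by simp) fun i => by
        rcases eq_or_ne i 0 with rfl | hi <;> simp [*, one_mem, zero_mem]
    rw [Polynomial.natDegree_X] at h1
    exact h1.trans hM
  · rw [MvPolynomial.aeval_def, MvPolynomial.eval₂_eq']
    refine Finset.sum_eq_zero fun m hm => ?_
    have hne : m ≠ Finsupp.single 0 M := fun e =>
      MvPolynomial.mem_support_iff.mp hm (e ▸ h)
    have hdeg : m.degree = M := by
      rw [Finsupp.degree_eq_weight_one]
      exact hF (MvPolynomial.mem_support_iff.mp hm)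
    -- Every monomial of degree M other than X₁^M contains another variable, hence vanishes at (1,
    -- 0, ..., 0).
    obtain ⟨i, hi, hmi⟩ : ∃ i : Fin (k + 2), i ≠ 0 ∧ m i ≠ 0 := by
      by_contra! hall
      have hs : m = Finsupp.single 0 (m 0) := by
        ext i
        rcases eq_or_ne i 0 with rfl | hi
        · simp
        · rw [hall i hi, Finsupp.single_eq_of_ne hi]
      rw [hs, Finsupp.degree_single] at hdeg
      exact hne (hdeg ▸ hs)
    rw [Finset.prod_eq_zero (Finset.mem_univ i) (by simp [hi, hmi]), mul_zero]
  · have h1 := absHeight_eq_heightOver (algebraMap K Qbar)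
      (y := (Pi.single 0 1 : Fin (k + 2) → K)) (by simp)
    rw [heightOver_single_one] at h1
    have h2 : (fun i => algebraMap K Qbar ((Pi.single 0 1 : Fin (k + 2) → K) i)) =
        Pi.single 0 1 := by
      funext i
      rcases eq_or_ne i 0 with rfl | hi <;> simp [*]
    rw [← h2, h1]
    exact one_le_mul_of_one_le_of_one_le (Real.one_le_sqrt.mpr one_le_two)
      (Real.one_le_rpow (one_le_polyHeight hF0) (by positivity))

theorem exists_small_zero_of_coeff_ne_zero {k M : ℕ} (hM : 1 ≤ M)
    {F : MvPolynomial (Fin (k + 2)) K} (hF : F.IsHomogeneous M)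
    (h : F.coeff (Finsupp.single 0 M) ≠ 0) :
    ∃ z : Fin (k + 2) → Qbar, z ≠ 0 ∧ degOver K z ≤ M ∧ MvPolynomial.aeval z F = 0 ∧
      absHeight z ≤ Real.sqrt 2 * polyHeight F ^ (1 / (M : ℝ)) := by
  have : IsAlgClosed Qbar := IsAlgClosure.isAlgClosed ℚ
  set f := dehomogenize F with hfdef
  have hcoeff : f.coeff M ≠ 0 := by
    rw [hfdef, coeff_dehomogenize_of_isHomogeneous hF M]
    simpa using h
  have hf0 : f ≠ 0 := fun e => hcoeff (by rw [e, Polynomial.coeff_zero])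
  have hdeg : f.natDegree = M :=
    (Polynomial.natDegree_le_iff_coeff_eq_zero.mpr fun j hj =>
      coeff_dehomogenize_of_lt hF hj).antisymm (Polynomial.le_natDegree_of_ne_zero hcoeff)
  let L := f.SplittingField
  have : NumberField L := NumberField.of_module_finite K L
  let φ : L →ₐ[K] Qbar := Polynomial.SplittingField.lift f (IsAlgClosed.splits _)
  obtain ⟨a, ha, hle⟩ := exists_heightOver_affinePoint_le (L := L) k (M := M) (by omega)
    (f := f.map (algebraMap K L)) (Polynomial.SplittingField.splits f)
    (by rw [Polynomial.natDegree_map, hdeg])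
  rw [Polynomial.eval_map_algebraMap] at ha
  have hheight : heightOver L (fun j : (f.map (algebraMap K L)).support =>
      (f.map (algebraMap K L)).coeff j) ≤ polyHeight F := by
    -- Mapping f to L only relabels the index set of its coefficients, as the support is unchanged.
    refine le_trans (le_of_eq ?_) (heightOver_dehomogenize_le hF hf0)
    have hx : (fun j : f.support => f.coeff j) ≠ 0 :=
      Function.ne_iff.mpr ⟨⟨M, Polynomial.mem_support_iff.mpr hcoeff⟩, hcoeff⟩
    rw [← heightOver_algebraMap (L := L) hx]
    have hs := Polynomial.support_map_of_injective f (algebraMap K L).injective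
    symm
    refine heightOver_comp_bijective ?_ _ (e := fun j => ⟨j.1, hs.symm.subset j.2⟩)
      ⟨fun i j hij => Subtype.ext (Subtype.mk.inj hij), fun j => ⟨⟨j.1, hs.subset j.2⟩, rfl⟩⟩
      fun j => (Polynomial.coeff_map _ _).symm
    obtain ⟨j, hj⟩ := Function.ne_iff.mp hx
    exact Function.ne_iff.mpr ⟨j, by simpa using hj⟩
  refine ⟨fun i => φ (affinePoint k a i), ?_, ?_, ?_, ?_⟩
  · obtain ⟨i, hi⟩ := Function.ne_iff.mp (affinePoint_ne_zero k a)
    exact Function.ne_iff.mpr ⟨i, by simpa using hi⟩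
  · rw [← hdeg]
    refine degOver_le_of_aeval_eq_zero hf0 (a := φ a)
      (by rw [Polynomial.aeval_algHom_apply, ha, map_zero]) fun i => ?_
    refine Fin.cases ?_ (fun i => ?_) i
    · exact IntermediateField.subset_adjoin K _ rfl
    refine Fin.cases ?_ (fun i => ?_) i
    · simp [affinePoint, one_mem]
    · simp [affinePoint, zero_mem]
  · rw [← MvPolynomial.comp_aeval_apply, ← aeval_dehomogenize, ← hfdef, ha, map_zero]
  · refine (absHeight_eq_heightOver φ.toRingHom (affinePoint_ne_zero k a)).trans_le
      (hle.trans ?_)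
    gcongr
    exact heightOver_nonneg _

end SmallZeros

/-! ### Lower bounds for the zeros of X₁^M - C X₂^M -/

section Binomial

variable {K : Type*} [Field K] [NumberField K] {Qbar : Type*} [Field Qbar] [Algebra ℚ Qbar]
  [IsAlgClosure ℚ Qbar] [Algebra K Qbar]

/-- Superadditivity of x ↦ x^M on nonnegative reals, applied to s² and t²; this is why no constant
is lost at the infinite places. -/
theorem sqrt_pow_add_pow_le {M : ℕ} (hM : M ≠ 0) (s t : ℝ) :
    Real.sqrt ((t ^ M) ^ 2 + (s ^ M) ^ 2) ≤ Real.sqrt (s ^ 2 + t ^ 2) ^ M := by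
  rw [← Real.sqrt_sq (pow_nonneg (Real.sqrt_nonneg (s ^ 2 + t ^ 2)) M), pow_right_comm (√_),
    Real.sq_sqrt (by positivity), pow_right_comm t, pow_right_comm s, add_comm]
  exact Real.sqrt_le_sqrt (pow_add_pow_le (sq_nonneg s) (sq_nonneg t) hM)

theorem polyHeight_nonneg {σ : Type*} (F : MvPolynomial σ K) : 0 ≤ polyHeight F := by
  rw [polyHeight]
  exact heightOver_nonneg _

theorem polyHeight_eq_heightOver {σ ι : Type*} [Fintype ι] [Nonempty ι] {F : MvPolynomial σ K}
    {x : ι → K} (hx : ∀ i, x i ≠ 0) {e : ι → σ →₀ ℕ} (he : Function.Injective e)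
    (hxe : ∀ i, x i = F.coeff (e i)) (hF : ∀ m ∈ F.support, ∃ i, e i = m) :
    polyHeight F = heightOver K x := by
  have hmem (i : ι) : e i ∈ F.support := by
    rw [MvPolynomial.mem_support_iff, ← hxe]
    exact hx i
  let e' : ι → F.support := fun i => ⟨e i, hmem i⟩
  have he' : Function.Bijective e' := by
    refine ⟨fun i j hij => he (Subtype.mk.inj hij), fun m => ?_⟩
    obtain ⟨i, hi⟩ := hF m m.2
    exact ⟨i, Subtype.ext hi⟩
  have hx0 : x ≠ 0 := Function.ne_iff.mpr ⟨Classical.arbitrary ι, hx _⟩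
  have key := @heightOver_comp_bijective K _ _ ι F.support _ _ x hx0 (fun m => F.coeff m) e'
  rw [polyHeight]
  exact (key he' hxe).symm

theorem polyHeight_binomial {M : ℕ} (hM : M ≠ 0) {C : K} (hC : C ≠ 0)
    {F : MvPolynomial (Fin 2) K}
    (hF : F = MvPolynomial.X 0 ^ M - MvPolynomial.C C * MvPolynomial.X 1 ^ M) :
    polyHeight F = heightOver K ![1, -C] := by
  classical
  have hne : (Finsupp.single 0 M : Fin 2 →₀ ℕ) ≠ Finsupp.single 1 M := fun h => by
    simpa [hM] using DFunLike.congr_fun h 0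
  have hcoeff (m : Fin 2 →₀ ℕ) : F.coeff m =
      (if Finsupp.single 0 M = m then 1 else 0) -
        C * if Finsupp.single 1 M = m then 1 else 0 := by
    rw [hF, MvPolynomial.coeff_sub, MvPolynomial.coeff_X_pow, MvPolynomial.coeff_C_mul,
      MvPolynomial.coeff_X_pow]
  refine polyHeight_eq_heightOver (e := ![Finsupp.single 0 M, Finsupp.single 1 M])
    (Fin.forall_fin_two.mpr ⟨by simp, by simpa using hC⟩) (fun i j hij => ?_)
    (Fin.forall_fin_two.mpr ⟨by simp [hcoeff, hne.symm], by simp [hcoeff, hne]⟩) fun m hm => ?_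
  · fin_cases i <;> fin_cases j
    · rfl
    · exact absurd hij hne
    · exact absurd hij hne.symm
    · rfl
  · by_contra! h
    rw [MvPolynomial.mem_support_iff, hcoeff] at hm
    simp [show Finsupp.single 0 M ≠ m from h 0, show Finsupp.single 1 M ≠ m from h 1] at hm

theorem heightOver_pair_le_pow {M : ℕ} (hM : M ≠ 0) {C : K} {z : Fin 2 → K} (hz : z ≠ 0)
    (h : z 0 ^ M = C * z 1 ^ M) : heightOver K ![1, -C] ≤ heightOver K z ^ M := by
  have hz1 : z 1 ≠ 0 := by
    intro h1
    rw [h1, zero_pow hM, mul_zero, pow_eq_zero_iff hM] at h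
    exact hz (funext fun i => by fin_cases i <;> simpa)
  have hpos : z 1 ^ M ≠ 0 := pow_ne_zero M hz1
  have hu : (![1, -C] : Fin 2 → K) ≠ 0 := Function.ne_iff.mpr ⟨0, by simp⟩
  have hd : Module.finrank ℚ K ≠ 0 := Module.finrank_pos.ne'
  refine le_of_pow_le_pow_left₀ hd (pow_nonneg (heightOver_nonneg z) _) ?_
  -- Scaling (1, -C) by z₂^M turns it into (z₂^M, -z₁^M). Its local norms equal the M-th powers of
  -- those of z at finite places, and are at most these powers at infinite ones.
  rw [pow_right_comm, heightOver_pow_finrank, heightOver_pow_finrank, ← placeProd_smul hpos hu]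
  have hfin (v : FinitePlace K) : ⨆ i, v ((z 1 ^ M • ![1, -C]) i) = (⨆ i, v (z i)) ^ M := by
    have h2 (x : Fin 2 → K) : ⨆ i, v (x i) = max (v (x 0)) (v (x 1)) := by
      refine le_antisymm (ciSup_le fun i => by fin_cases i <;> simp)
        (max_le (le_iSup_finitePlace v x 0) (le_iSup_finitePlace v x 1))
    have h3 : v (z 1 ^ M * -C) = v (z 0) ^ M := by
      rw [← map_pow, h, mul_comm, neg_mul, map_neg_eq_map]
    rw [h2, h2]
    simp only [Pi.smul_apply, smul_eq_mul, Matrix.cons_val_zero, Matrix.cons_val_one, mul_one, h3]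
    rw [map_pow, max_comm]
    exact ((pow_left_monotoneOn (n := M)).map_max (apply_nonneg v (z 0))
      (apply_nonneg v (z 1))).symm
  rw [placeProd, placeProd, mul_pow, ← Finset.prod_pow,
    finprod_pow (hasFiniteMulSupport_iSup_finitePlace hz), finprod_congr hfin]
  refine mul_le_mul_of_nonneg_right (Finset.prod_le_prod (fun v _ =>
    pow_nonneg (archNorm_nonneg v _) _) fun v _ => ?_)
    (finprod_nonneg fun v => pow_nonneg (iSup_finitePlace_nonneg v z) _)
  rw [pow_right_comm]
  refine pow_le_pow_left₀ (archNorm_nonneg v _) ?_ _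
  have h3 : v (z 1 ^ M * -C) = v (z 0) ^ M := by
    rw [← map_pow, h, mul_comm, neg_mul, v.coe_apply, v.1.map_neg]
    rfl
  simp only [archNorm, Fin.sum_univ_two, Pi.smul_apply, smul_eq_mul, Matrix.cons_val_zero,
    Matrix.cons_val_one, mul_one, h3, map_pow]
  exact sqrt_pow_add_pow_le hM _ _

theorem polyHeight_binomial_rpow_le {M : ℕ} (hM : M ≠ 0) {C : K} (hC : C ≠ 0)
    {F : MvPolynomial (Fin 2) K}
    (hF : F = MvPolynomial.X 0 ^ M - MvPolynomial.C C * MvPolynomial.X 1 ^ M)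
    {z : Fin 2 → Qbar} (hz : z ≠ 0) (h : MvPolynomial.aeval z F = 0) :
    polyHeight F ^ (1 / (M : ℝ)) ≤ absHeight z := by
  have halg : Algebra.IsAlgebraic ℚ Qbar := IsAlgClosure.isAlgebraic
  let L := IntermediateField.adjoin K (Set.range z)
  have : Module.Finite K L := IntermediateField.finiteDimensional_adjoin fun y _ =>
    ((Algebra.IsAlgebraic.isAlgebraic (R := ℚ) y).tower_top K).isIntegral
  have : NumberField L := NumberField.of_module_finite K L
  let y : Fin 2 → L := fun i => ⟨z i, IntermediateField.subset_adjoin K _ ⟨i, rfl⟩⟩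
  have hy : y ≠ 0 := by
    obtain ⟨i, hi⟩ := Function.ne_iff.mp hz
    exact Function.ne_iff.mpr ⟨i, fun e => hi (congrArg Subtype.val e)⟩
  have hrel : y 0 ^ M = algebraMap K L C * y 1 ^ M := by
    refine Subtype.ext ?_
    rw [hF] at h
    simpa [sub_eq_zero] using h
  have hheight := absHeight_eq_heightOver (algebraMap L Qbar) hy
  rw [show (fun i => algebraMap L Qbar (y i)) = z from rfl] at hheight
  have hle := heightOver_pair_le_pow hM hy hrel
  have hpair : heightOver L ![1, -algebraMap K L C] = heightOver K ![1, -C] := by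
    rw [← heightOver_algebraMap (L := L) (x := ![1, -C]) (Function.ne_iff.mpr ⟨0, by simp⟩)]
    congr 1
    funext i
    fin_cases i <;> simp
  rw [hpair, ← polyHeight_binomial hM hC hF, ← hheight] at hle
  have habs : 0 ≤ absHeight z := hheight ▸ heightOver_nonneg y
  calc _ ≤ (absHeight z ^ M) ^ (1 / (M : ℝ)) :=
        Real.rpow_le_rpow (polyHeight_nonneg F) hle (by positivity)
    _ = absHeight z := by rw [one_div, Real.pow_rpow_inv_natCast habs hM]

/-- Each infinite place contributes at least n to the power of its local degree, and these degrees
add up to [K : ℚ]; the coordinate 1 keeps every finite factor at least 1. -/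
theorem natCast_le_heightOver_pair (n : ℕ) : (n : ℝ) ≤ heightOver K ![1, -(n : K)] := by
  have hd : Module.finrank ℚ K ≠ 0 := Module.finrank_pos.ne'
  refine le_of_pow_le_pow_left₀ hd (heightOver_nonneg _) ?_
  rw [heightOver_pow_finrank, placeProd, ← InfinitePlace.sum_mult_eq (K := K),
    ← Finset.prod_pow_eq_pow_sum]
  have hfin (v : FinitePlace K) : 1 ≤ ⨆ i, v (![1, -(n : K)] i) := by
    simpa using le_iSup_finitePlace v ![1, -(n : K)] 0
  refine le_trans ?_ (le_mul_of_one_le_right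
    (Finset.prod_nonneg fun v _ => pow_nonneg (archNorm_nonneg v _) _) (one_le_finprod hfin))
  · refine Finset.prod_le_prod (fun v _ => by positivity) fun v _ => ?_
    refine pow_le_pow_left₀ (by positivity) (Real.le_sqrt_of_sq_le ?_) _
    simp [Fin.sum_univ_two, ← v.norm_embedding_eq]

theorem exists_binomial_height_gt {M : ℕ} (hM : M ≠ 0) {θ : ℝ} (hθ : θ < 1 / (M : ℝ)) (c : ℝ) :
    ∃ F : MvPolynomial (Fin 2) K, F.IsHomogeneous M ∧ F ≠ 0 ∧
      ∀ z : Fin 2 → Qbar, z ≠ 0 → MvPolynomial.aeval z F = 0 →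
        c * polyHeight F ^ θ < absHeight z := by
  have hε : 0 < 1 / (M : ℝ) - θ := sub_pos.mpr hθ
  -- Choosing n^(1/M - θ) > c suffices: H(F) ≥ n, and H(F)^(1/M) = H(F)^(1/M - θ) · H(F)^θ, where θ
  -- may be negative.
  obtain ⟨n, hn, hn1⟩ := (((tendsto_rpow_atTop hε).comp
    tendsto_natCast_atTop_atTop).eventually_gt_atTop c |>.and
      (Filter.eventually_ge_atTop 1)).exists
  have hC : (n : K) ≠ 0 := by exact_mod_cast (by omega : n ≠ 0)
  have hH := polyHeight_binomial hM hC rfl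
  have hnH := natCast_le_heightOver_pair (K := K) n
  refine ⟨MvPolynomial.X 0 ^ M - MvPolynomial.C (n : K) * MvPolynomial.X 1 ^ M, ?_, ?_,
    fun z hz hzero => ?_⟩
  · refine (MvPolynomial.isHomogeneous_X_pow _ _).sub ?_
    simpa using (MvPolynomial.isHomogeneous_C (Fin 2) (n : K)).mul
      (MvPolynomial.isHomogeneous_X_pow (R := K) (1 : Fin 2) M)
  · rintro h0
    have h1 := congrArg (MvPolynomial.eval ![1, 0]) h0
    simp [hM] at h1
  · refine lt_of_lt_of_le ?_ (polyHeight_binomial_rpow_le hM hC rfl hz hzero)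
    rw [hH]
    have hpos : 0 < heightOver K ![1, -(n : K)] :=
      lt_of_lt_of_le (by exact_mod_cast hn1) hnH
    have hc : c < heightOver K ![1, -(n : K)] ^ (1 / (M : ℝ) - θ) :=
      hn.trans_le (Real.rpow_le_rpow (by positivity) hnH hε.le)
    calc _ < heightOver K ![1, -(n : K)] ^ (1 / (M : ℝ) - θ) * heightOver K ![1, -(n : K)] ^ θ :=
          mul_lt_mul_of_pos_right hc (Real.rpow_pos_of_pos hpos θ)
      _ = _ := by rw [← Real.rpow_add hpos, sub_add_cancel]

end Binomial

theorem proposition1 (K : Type*) [Field K] [NumberField K]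
    (Qbar : Type*) [Field Qbar] [Algebra ℚ Qbar] [IsAlgClosure ℚ Qbar] [Algebra K Qbar]
    (M : ℕ) (hM : 1 ≤ M) :
    -- small zeros exist
    (∀ N : ℕ, 2 ≤ N → ∀ F : MvPolynomial (Fin N) K, F.IsHomogeneous M → F ≠ 0 →
      ∃ z : Fin N → Qbar, z ≠ 0 ∧ degOver K z ≤ M ∧
        MvPolynomial.aeval z F = 0 ∧
        absHeight z ≤ Real.sqrt 2 * polyHeight F ^ (1 / (M : ℝ))) ∧
    -- for two variables, the exponent cannot be lowered, whatever the constant,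
    -- and whatever the degree of the zero
    (∀ θ : ℝ, θ < 1 / (M : ℝ) → ∀ c : ℝ,
      ∃ F : MvPolynomial (Fin 2) K, F.IsHomogeneous M ∧ F ≠ 0 ∧
        ∀ z : Fin 2 → Qbar, z ≠ 0 → MvPolynomial.aeval z F = 0 →
          c * polyHeight F ^ θ < absHeight z) ∧
    -- explicitly, for the forms `X₁ ^ M - C * X₂ ^ M`
    (∀ C : K, C ≠ 0 → ∀ z : Fin 2 → Qbar, z ≠ 0 →
      MvPolynomial.aeval z
        (MvPolynomial.X 0 ^ M - MvPolynomial.C C * MvPolynomial.X 1 ^ M :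
          MvPolynomial (Fin 2) K) = 0 →
      1 / Real.sqrt 2 *
        polyHeight (MvPolynomial.X 0 ^ M - MvPolynomial.C C * MvPolynomial.X 1 ^ M :
          MvPolynomial (Fin 2) K) ^ (1 / (M : ℝ)) ≤ absHeight z) := by
  have hM0 : M ≠ 0 := by omega
  refine ⟨fun N hN F hF hF0 => ?_, fun θ hθ c => exists_binomial_height_gt hM0 hθ c,
    fun C hC z hz h => ?_⟩
  · obtain ⟨k, rfl⟩ := Nat.exists_eq_add_of_le' hN
    by_cases h : F.coeff (Finsupp.single 0 M) = 0
    · exact exists_small_zero_of_coeff_eq_zero hM hF hF0 h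
    · exact exists_small_zero_of_coeff_ne_zero hM hF h
  -- The factor 1/√2 is slack, as the bound holds with constant 1.
  · refine le_trans (mul_le_of_le_one_left (Real.rpow_nonneg (polyHeight_nonneg _) _) ?_)
      (polyHeight_binomial_rpow_le hM0 hC rfl hz h)
    exact div_le_one_of_le₀ (Real.one_le_sqrt.mpr one_le_two) (Real.sqrt_nonneg 2)
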